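/- **Theorem 6.** Let $L\ge 1$ and $N\ge 1$ be integers, let $\Gamma>0$ be real, and let $M_1<M_2<\dots<M_L$ be pairwise coprime positive integers. Put $m_l=\Gamma M_l$, and for real $x$ and $m>0$ write $\langle x\rangle_m = x-m\lfloor x/m\rfloor\in[0,m)$ for the residue of $x$ modulo $m$. Let $$D=\min_{\mathcal U}\left(\frac{\operatorname{lcm}(M_l\in\mathcal U)+\operatorname{lcm}(M_l\in\bar{\mathcal U})}{2}-1\right)\Gamma ,$$ where $\mathcal U$ runs over the subsets of the set of the first $\lceil L/N\rceil$ moduli $\{M_1,\dots,M_{\lceil L/N\rceil}\}$, $\bar{\mathcal U}$ is the complement of $\mathcal U$ in that set, and the lcm of the empty set is $1$. Then the $N$ frequencies of a real waveform can be robustly reconstructed from the unordered sets of noisy residues of $X_i$ and $-X_i$: there is a decoding map, depending only on $\Gamma$, $N$ and $M_1,\dots,M_L$, that takes $L$ sets of real numbers to a set of real numbers and has the following property. Whenever $X_1,\dots,X_N$ are real numbers in $[0,D)$ and $\Delta^{+}_{il},\Delta^{-}_{il}$ ($1\le i\le N$, $1\le l\le L$) are real errors with $|\Delta^{+}_{il}|<\Gamma/4$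 and $|\Delta^{-}_{il}|<\Gamma/4$, the set that the map assigns to $$\mathcal R_l=\{\langle X_i+\Delta^{+}_{il}\rangle_{m_l},\ \langle -X_i+\Delta^{-}_{il}\rangle_{m_l}\;:\;i=1,\dots,N\},\qquad l=1,\dots,L,$$ can be written as $\{\hat X_1,\dots,\hat X_N\}$ (repetitions allowed) with $|\hat X_i-X_i|<3\Gamma/4$ for every $i=1,\dots,N$. -/

import Mathlib

namespace RobustRemainder

/-- The residue `⟨x⟩_m` of a real number `x` modulo a positive real number `m`; it lies in `[0, m)`. -/
noncomputable def realMod (m x : ℝ) : ℝ := x - m * (⌊x / m⌋ : ℝ)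

/-- The noisy residue set of the real waveform model at the sampler with modulus `m`: the unordered
set of all `⟨X i + Δ⁺ i⟩_m` and all `⟨-X i + Δ⁻ i⟩_m`. It neither records which residue belongs to
which index `i`, nor whether a residue comes from `X i` or from `-X i`. -/
def residueSet {N : ℕ} (m : ℝ) (X Δpos Δneg : Fin N → ℝ) : Set ℝ :=
  {r | ∃ i, r = realMod m (X i + Δpos i) ∨ r = realMod m (-X i + Δneg i)}

/-- The indices of the first `⌈L / N⌉` moduli. -/
def firstModuli (L N : ℕ) : Finset (Fin L) :=
  Finset.univ.filter fun l => (l : ℕ) < ⌈(L : ℚ) / (N : ℚ)⌉₊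

/-- The dynamic range `D = min_U ((lcm (M l, l ∈ U) + lcm (M l, l ∈ Uᶜ)) / 2 - 1) Γ`, where `U` and
`Uᶜ` partition the first `⌈L / N⌉` indices. One of the two parts may be empty; the lcm of the empty
family is `1`. -/
noncomputable def dynamicRange {L : ℕ} (Γ : ℝ) (M : Fin L → ℕ) (N : ℕ) : ℝ :=
  ((firstModuli L N).powerset.inf' ⟨∅, Finset.empty_mem_powerset _⟩ fun U =>
    (((U.lcm M : ℕ) : ℝ) + (((firstModuli L N \ U).lcm M : ℕ) : ℝ)) / 2 - 1) * Γ

end RobustRemainder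

/-!
Let `D` be the dynamic range. From the residue sets `R l` alone, form the set `C` of all
`y ∈ [0, D)` that, for every `l`, lie within `Γ / 4` of an element of `R l` modulo `Γ * M l`.

Every frequency `X i` lies in `C`. Conversely every `y ∈ C` lies within `Γ / 2` of some `X i`
(`exists_abs_sub_lt_of_mem_candidates`): for every `l`, `y` is within `Γ / 2` of `X i` or of `-X i`
modulo `Γ * M l` for some `i`, and by the pigeonhole principle one index `i` serves at least
`⌈L / N⌉` of the moduli. Let `A` be the product of those among them where the sign is `+`, and `B`
the product of the others. Within distance `Γ / 2` a multiple of `Γ` is determined, so by coprimality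
`y - X i` is near `0` or near a nonzero multiple of `Γ * A`, and `y + X i` is near `0` or near a
nonzero multiple of `Γ * B`. If neither is near `0`, then `|y - X i| + |y + X i| = 2 * max y (X i)`
is at least `Γ * (A + B - 2)`, which is at least `2 * D`: a contradiction.

It remains to choose finitely many points from `C` in a way that suits all `X` with the given
residue sets. Cut `C` greedily from the left: `c₁ = inf C`, `c₂ = inf (C ∩ [c₁ + Γ, ∞))`, and so on
(`exists_greedy_cut`). The estimates are the numbers `c + Γ / 4`. Each `X i` lies in some
`[c, c + Γ)`, so it is within `3 * Γ / 4` of an estimate; and each `c` has some `X i` in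
`(c - Γ / 2, c + Γ / 2]`. These intervals are disjoint, so the estimates can be assigned to distinct
indices, and all of them are used (`exists_range_eq_image_of_cut`).
-/

namespace RobustRemainder

/-! ### Real numbers near multiples of several coprime moduli -/

/-- A real number within `Γ / 2` of a multiple of each `Γ * m l`, `l ∈ s`, is near `0` or has size
about `Γ * ∏ l ∈ s, m l` at least. The term `-1` also makes this true for empty `s`. -/
theorem abs_lt_or_le_abs_of_near_multiples {ι : Type*} (s : Finset ι) (m : ι → ℕ)
    (hm : (s : Set ι).Pairwise fun k l => Nat.Coprime (m k) (m l)) {Γ : ℝ} (hΓ : 0 < Γ) (z : ℝ)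
    (hz : ∀ l ∈ s, ∃ k : ℤ, |z - k * (Γ * m l)| < Γ / 2) :
    |z| < Γ / 2 ∨ Γ * (((∏ l ∈ s, m l : ℕ) : ℝ) - 1) ≤ |z| := by
  rcases s.eq_empty_or_nonempty with rfl | ⟨l₀, hl₀⟩
  · right; simp
  obtain ⟨k₀, hk₀⟩ := hz l₀ hl₀
  have hdvd : (∏ l ∈ s, (m l : ℤ)) ∣ k₀ * m l₀ := by
    refine Finset.prod_dvd_of_coprime (fun a ha b hb hab => ?_) fun l hl => ?_
    · exact Nat.isCoprime_iff_coprime.2 (hm ha hb hab)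
    · obtain ⟨k, hk⟩ := hz l hl
      -- Two multiples of `Γ` within `Γ / 2` of `z` coincide.
      have h : |((k₀ * m l₀ - k * m l : ℤ) : ℝ)| < 1 := by
        rw [abs_lt] at hk hk₀ ⊢
        push_cast
        constructor <;> nlinarith
      have h' : k₀ * m l₀ - k * m l = 0 := Int.abs_lt_one_iff.1 (by exact_mod_cast h)
      exact ⟨k, by linarith⟩
  by_cases h0 : k₀ * (m l₀ : ℤ) = 0
  · left
    have h0' : (k₀ : ℝ) * m l₀ = 0 := by exact_mod_cast h0
    rwa [show (k₀ : ℝ) * (Γ * m l₀) = Γ * (k₀ * m l₀) by ring, h0', mul_zero, sub_zero] at hk₀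
  · right
    have hle : (∏ l ∈ s, (m l : ℤ)) ≤ |k₀ * (m l₀ : ℤ)| :=
      Int.le_of_dvd (abs_pos.2 h0) ((dvd_abs _ _).2 hdvd)
    have hle' : ((∏ l ∈ s, m l : ℕ) : ℝ) ≤ |(k₀ : ℝ) * m l₀| := by exact_mod_cast hle
    have h1 : |(k₀ : ℝ) * (Γ * m l₀)| = Γ * |(k₀ : ℝ) * m l₀| := by
      rw [show (k₀ : ℝ) * (Γ * m l₀) = Γ * (k₀ * m l₀) by ring, abs_mul, abs_of_pos hΓ]
    have h2 := abs_sub_abs_le_abs_sub ((k₀ : ℝ) * (Γ * m l₀)) z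
    rw [abs_sub_comm] at h2
    nlinarith [mul_le_mul_of_nonneg_left hle' hΓ.le]

/-! ### The dynamic range and large sets of moduli -/

theorem lcm_le_prod_comp {ι : Type*} (s : Finset ι) (M M' : ι → ℕ)
    (hM : ∀ l ∈ s, 0 < M l) (h : ∀ l ∈ s, M l ≤ M' l) : s.lcm M ≤ ∏ l ∈ s, M' l :=
  (Nat.le_of_dvd (Finset.prod_pos hM) (Finset.lcm_dvd fun _ hl => Finset.dvd_prod_of_mem _ hl)).trans
    (Finset.prod_le_prod' h)

theorem val_le_val_of_strictMono {k L : ℕ} {f : Fin k → Fin L} (hf : StrictMono f) (j : Fin k) :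
    (j : ℕ) ≤ f j := by
  obtain ⟨j, hj⟩ := j
  induction j with
  | zero => simp
  | succ j ih =>
    have h1 := ih (by omega)
    have h2 : f ⟨j, by omega⟩ < f ⟨j + 1, hj⟩ := hf (Fin.mk_lt_mk.2 (Nat.lt_succ_self j))
    exact Nat.succ_le_of_lt (h1.trans_lt h2)

/-- The moduli increase, so moving a partition of the first `⌈L / N⌉` indices to larger indices can
only increase the two products. Hence for every set `F` of at least `⌈L / N⌉` indices and every
predicate `p`, some `U` inside the part of `F` where `p` holds and some `V` inside the rest have
products that bound the dynamic range. -/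
theorem exists_dynamicRange_le {L N : ℕ} {Γ : ℝ} (hΓ : 0 < Γ) {M : Fin L → ℕ}
    (hMpos : ∀ l, 0 < M l) (hMmono : StrictMono M) (F : Finset (Fin L))
    (hF : ⌈(L : ℚ) / (N : ℚ)⌉₊ ≤ F.card) (p : Fin L → Prop) :
    ∃ U V : Finset (Fin L), (∀ l ∈ U, l ∈ F ∧ p l) ∧ (∀ l ∈ V, l ∈ F ∧ ¬ p l) ∧
      dynamicRange Γ M N ≤
        ((((∏ l ∈ U, M l : ℕ) : ℝ) + ((∏ l ∈ V, M l : ℕ) : ℝ)) / 2 - 1) * Γ := by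
  classical
  let e := F.orderEmbOfCardLe hF
  -- The `l`-th smallest index of `F`, for `l < ⌈L / N⌉`; the other values do not matter.
  let φ : Fin L → Fin L := fun l =>
    if h : (l : ℕ) < ⌈(L : ℚ) / (N : ℚ)⌉₊ then e ⟨l, h⟩ else l
  have hlt : ∀ l ∈ firstModuli L N, (l : ℕ) < ⌈(L : ℚ) / (N : ℚ)⌉₊ := fun l hl =>
    (Finset.mem_filter.1 hl).2
  have hφ : ∀ l (hl : l ∈ firstModuli L N), φ l = e ⟨l, hlt l hl⟩ := fun l hl =>
    dif_pos (hlt l hl)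
  have hφF : ∀ l ∈ firstModuli L N, φ l ∈ F := fun l hl => by
    rw [hφ l hl]; exact F.orderEmbOfCardLe_mem hF _
  have hφle : ∀ l ∈ firstModuli L N, l ≤ φ l := fun l hl => by
    rw [hφ l hl]
    exact val_le_val_of_strictMono e.strictMono ⟨l, hlt l hl⟩
  have hφinj : Set.InjOn φ (firstModuli L N) := fun a ha b hb hab => by
    rw [hφ a ha, hφ b hb] at hab
    exact Fin.ext (Fin.mk.inj_iff.1 (e.injective hab))
  have hbound : ∀ W ⊆ firstModuli L N, W.lcm M ≤ ∏ l ∈ W.image φ, M l := fun W hW => by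
    rw [Finset.prod_image (hφinj.mono (by exact_mod_cast hW))]
    exact lcm_le_prod_comp W M (fun l => M (φ l)) (fun _ _ => hMpos _)
      fun l hl => hMmono.monotone (hφle l (hW hl))
  let U₀ := (firstModuli L N).filter fun l => p (φ l)
  have hU₀ : U₀ ⊆ firstModuli L N := Finset.filter_subset _ _
  refine ⟨U₀.image φ, (firstModuli L N \ U₀).image φ, ?_, ?_, ?_⟩
  · simp only [Finset.forall_mem_image]
    intro l hl
    exact ⟨hφF l (hU₀ hl), (Finset.mem_filter.1 hl).2⟩
  · simp only [Finset.forall_mem_image]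
    intro l hl
    obtain ⟨hl1, hl2⟩ := Finset.mem_sdiff.1 hl
    exact ⟨hφF l hl1, fun h => hl2 (Finset.mem_filter.2 ⟨hl1, h⟩)⟩
  · have h1 : ((U₀.lcm M : ℕ) : ℝ) ≤ ((∏ l ∈ U₀.image φ, M l : ℕ) : ℝ) := by
      exact_mod_cast hbound U₀ hU₀
    have h2 : (((firstModuli L N \ U₀).lcm M : ℕ) : ℝ) ≤
        ((∏ l ∈ (firstModuli L N \ U₀).image φ, M l : ℕ) : ℝ) := by
      exact_mod_cast hbound _ Finset.sdiff_subset
    refine mul_le_mul_of_nonneg_right ?_ hΓ.le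
    exact (Finset.inf'_le _ (Finset.mem_powerset.2 hU₀)).trans (by linarith)

/-! ### Candidates compatible with the residue sets -/

/-- The numbers in the dynamic range that are within `Γ / 4` of an element of `R l` modulo `Γ * M l`,
for every `l`. -/
def candidates {L : ℕ} (Γ : ℝ) (M : Fin L → ℕ) (N : ℕ) (R : Fin L → Set ℝ) : Set ℝ :=
  {y | y ∈ Set.Ico 0 (dynamicRange Γ M N) ∧
    ∀ l, ∃ r ∈ R l, ∃ k : ℤ, |y - r - k * (Γ * M l)| < Γ / 4}

theorem mem_candidates {L N : ℕ} {Γ : ℝ} {M : Fin L → ℕ} {X : Fin N → ℝ}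
    {Δpos Δneg : Fin L → Fin N → ℝ} (hX : ∀ i, X i ∈ Set.Ico 0 (dynamicRange Γ M N))
    (hΔ : ∀ l i, |Δpos l i| < Γ / 4 ∧ |Δneg l i| < Γ / 4) (i : Fin N) :
    X i ∈ candidates Γ M N fun l => residueSet (Γ * (M l : ℝ)) X (Δpos l) (Δneg l) := by
  refine ⟨hX i, fun l => ⟨_, ⟨i, Or.inl rfl⟩, ⌊(X i + Δpos l i) / (Γ * M l)⌋, ?_⟩⟩
  have h : X i - realMod (Γ * M l) (X i + Δpos l i) -
      (⌊(X i + Δpos l i) / (Γ * M l)⌋ : ℝ) * (Γ * M l) = -Δpos l i := by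
    unfold realMod; ring
  rw [h, abs_neg]
  exact (hΔ l i).1

theorem abs_sub_add_mul_lt {Γ m y x δ : ℝ} {k : ℤ} (hδ : |δ| < Γ / 4)
    (h : |y - realMod m (x + δ) - k * m| < Γ / 4) : ∃ k' : ℤ, |y - x - k' * m| < Γ / 2 := by
  refine ⟨k - ⌊(x + δ) / m⌋, ?_⟩
  unfold realMod at h
  push_cast
  rw [abs_lt] at *
  constructor <;> linarith

/-- Every candidate lies within `Γ / 2` of one of the frequencies that produced the residue sets. -/
theorem exists_abs_sub_lt_of_mem_candidates {L N : ℕ} (hN : 0 < N) {Γ : ℝ} (hΓ : 0 < Γ)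
    {M : Fin L → ℕ} (hMpos : ∀ l, 0 < M l) (hMmono : StrictMono M)
    (hMcop : Pairwise fun k l => Nat.Coprime (M k) (M l)) {X : Fin N → ℝ}
    {Δpos Δneg : Fin L → Fin N → ℝ} (hX : ∀ i, X i ∈ Set.Ico 0 (dynamicRange Γ M N))
    (hΔ : ∀ l i, |Δpos l i| < Γ / 4 ∧ |Δneg l i| < Γ / 4) {y : ℝ}
    (hy : y ∈ candidates Γ M N fun l => residueSet (Γ * (M l : ℝ)) X (Δpos l) (Δneg l)) :
    ∃ i, |y - X i| < Γ / 2 := by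
  classical
  obtain ⟨⟨hy0, hyD⟩, hy⟩ := hy
  have hnear : ∀ l, ∃ i, (∃ k : ℤ, |y - X i - k * (Γ * M l)| < Γ / 2) ∨
      ∃ k : ℤ, |y + X i - k * (Γ * M l)| < Γ / 2 := by
    intro l
    obtain ⟨r, ⟨i, rfl | rfl⟩, k, hk⟩ := hy l
    · exact ⟨i, Or.inl (abs_sub_add_mul_lt (hΔ l i).1 hk)⟩
    · refine ⟨i, Or.inr ?_⟩
      simpa only [sub_neg_eq_add] using abs_sub_add_mul_lt (hΔ l i).2 hk
  choose f hf using hnear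
  have : Nonempty (Fin N) := ⟨⟨0, hN⟩⟩
  obtain ⟨i, -, hi⟩ := Finset.exists_le_card_fiber_of_nsmul_le_card_of_maps_to
    (s := (Finset.univ : Finset (Fin L))) (t := (Finset.univ : Finset (Fin N))) (f := f)
    (b := (L : ℚ) / N) (fun _ _ => Finset.mem_univ _) Finset.univ_nonempty (by
      have : (N : ℚ) ≠ 0 := by exact_mod_cast hN.ne'
      simp only [Finset.card_univ, Fintype.card_fin, nsmul_eq_mul]
      rw [mul_div_cancel₀ _ this])
  obtain ⟨U, V, hU, hV, hD⟩ := exists_dynamicRange_le (N := N) hΓ hMpos hMmono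
    (Finset.univ.filter fun l => f l = i) (Nat.ceil_le.2 hi)
    (fun l => ∃ k : ℤ, |y - X i - k * (Γ * M l)| < Γ / 2)
  have hA := abs_lt_or_le_abs_of_near_multiples U M (hMcop.set_pairwise _) hΓ (y - X i)
    fun l hl => (hU l hl).2
  have hB := abs_lt_or_le_abs_of_near_multiples V M (hMcop.set_pairwise _) hΓ (y + X i)
    fun l hl => by
      obtain ⟨h1, h2⟩ := hV l hl
      obtain rfl := (Finset.mem_filter.1 h1).2
      exact (hf l).resolve_left h2
  obtain ⟨hx0, hxD⟩ := hX i
  refine ⟨i, ?_⟩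
  rcases hA with hA | hA
  · exact hA
  rw [abs_of_nonneg (add_nonneg hy0 hx0)] at hB
  rcases hB with hB | hB
  · rw [abs_lt]; constructor <;> linarith
  · exfalso
    rcases abs_cases (y - X i) with h | h <;> nlinarith

/-! ### Greedy cut of a bounded set of reals -/

/-- A bounded set `C` of reals is covered by finitely many intervals `[c, c + w)`, whose left ends
`c` are at least `w` apart and are limits of points of `C` from the right. -/
theorem exists_greedy_cut (w : ℝ) (n : ℕ) : ∀ (a : ℝ) (C : Set ℝ),
    C ⊆ Set.Ico a (a + n * w) → ∃ T : Finset ℝ,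
      (∀ c ∈ T, ∀ c' ∈ T, c < c' → c + w ≤ c') ∧ (∀ y ∈ C, ∃ c ∈ T, c ≤ y ∧ y < c + w) ∧
      ∀ c ∈ T, ∀ ε > 0, ∃ y ∈ C, c ≤ y ∧ y < c + ε := by
  induction n with
  | zero =>
    intro a C hC
    refine ⟨∅, by simp, fun y hy => ?_, by simp⟩
    have := hC hy
    simp at this
  | succ n ih =>
    intro a C hC
    rcases C.eq_empty_or_nonempty with rfl | hne
    · exact ⟨∅, by simp, by simp, by simp⟩
    have hbdd : BddBelow C := ⟨a, fun y hy => (hC hy).1⟩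
    have hac : a ≤ sInf C := le_csInf hne fun y hy => (hC hy).1
    obtain ⟨T, hsep, hcov, hlim⟩ := ih (a + w) (C ∩ Set.Ici (sInf C + w)) fun y hy => by
      have h1 := (hC hy.1).2
      have h2 : sInf C + w ≤ y := hy.2
      push_cast at h1
      exact ⟨by linarith, by linarith⟩
    have hT : ∀ c ∈ T, sInf C + w ≤ c := fun c hc => le_of_forall_pos_lt_add fun ε hε => by
      obtain ⟨y, hy, -, hlt⟩ := hlim c hc ε hε
      exact lt_of_le_of_lt hy.2 hlt
    refine ⟨insert (sInf C) T, ?_, fun y hy => ?_, ?_⟩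
    · simp only [Finset.mem_insert]
      rintro c (rfl | hc) c' (rfl | hc') hlt
      · exact absurd hlt (lt_irrefl _)
      · exact hT c' hc'
      · linarith [hT c hc]
      · exact hsep c hc c' hc' hlt
    · rcases lt_or_ge y (sInf C + w) with h | h
      · exact ⟨_, Finset.mem_insert_self _ _, csInf_le hbdd hy, h⟩
      · obtain ⟨c, hc, h'⟩ := hcov y ⟨hy, h⟩
        exact ⟨c, Finset.mem_insert_of_mem hc, h'⟩
    · simp only [Finset.mem_insert]
      rintro c (rfl | hc) ε hε
      · obtain ⟨y, hy, hlt⟩ := exists_lt_of_csInf_lt hne (lt_add_of_pos_right (sInf C) hε)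
        exact ⟨y, hy, csInf_le hbdd hy, hlt⟩
      · obtain ⟨y, hy, h⟩ := hlim c hc ε hε
        exact ⟨y, hy.1, h⟩

/-- If the points of `C` accumulate at `c` from the right and are all near some `X i`, then some
`X i` lies in `(c - w / 2, c + w / 2]`. Half-openness makes these intervals disjoint for points `c`
that are exactly `w` apart. -/
theorem exists_mem_Ioc_of_limit {ι : Type*} [Finite ι] {w c : ℝ} {C : Set ℝ} {X : ι → ℝ}
    (hC : ∀ y ∈ C, ∃ i, |y - X i| < w / 2) (hc : ∀ ε > 0, ∃ y ∈ C, c ≤ y ∧ y < c + ε) :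
    ∃ i, c - w / 2 < X i ∧ X i ≤ c + w / 2 := by
  by_contra! h
  have hev : ∀ᶠ ε in nhdsWithin (0 : ℝ) (Set.Ioi 0), ∀ i, c - w / 2 < X i → c + w / 2 + ε < X i := by
    refine Filter.eventually_all.2 fun i => ?_
    by_cases hi : c - w / 2 < X i
    · have h0 : (0 : ℝ) < X i - (c + w / 2) := sub_pos.2 (h i hi)
      filter_upwards [Ioo_mem_nhdsGT h0] with ε hε _
      linarith [hε.2]
    · exact Filter.Eventually.of_forall fun _ h' => absurd h' hi
  obtain ⟨ε, hε, hε0⟩ := (hev.and self_mem_nhdsWithin).exists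
  obtain ⟨y, hy, hcy, hyc⟩ := hc ε hε0
  obtain ⟨i, hi⟩ := hC y hy
  rw [abs_lt] at hi
  linarith [hε i (by linarith)]

/-- The points `c + w / 4`, for the left ends `c` of a greedy cut of `C`, are estimates, with
repetitions, of any finite family in `C` that comes within `w / 2` of every point of `C`. -/
theorem exists_range_eq_image_of_cut {ι : Type*} [Finite ι] {w : ℝ} {C : Set ℝ} {X : ι → ℝ}
    {T : Finset ℝ} (hsep : ∀ c ∈ T, ∀ c' ∈ T, c < c' → c + w ≤ c')
    (hcov : ∀ y ∈ C, ∃ c ∈ T, c ≤ y ∧ y < c + w)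
    (hlim : ∀ c ∈ T, ∀ ε > 0, ∃ y ∈ C, c ≤ y ∧ y < c + ε)
    (hXC : ∀ i, X i ∈ C) (hC : ∀ y ∈ C, ∃ i, |y - X i| < w / 2) :
    ∃ Xhat : ι → ℝ, Set.range Xhat = (fun c => c + w / 4) '' (T : Set ℝ) ∧
      ∀ i, |Xhat i - X i| < 3 * w / 4 := by
  classical
  -- An index with `X i ∈ (c - w / 2, c + w / 2]` for some `c ∈ T` must get the estimate of that `c`,
  -- since it may be the only one that can take it.
  have hchoice : ∀ i, ∃ c ∈ T, (c - w / 2 < X i ∧ X i < c + w) ∧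
      ∀ c' ∈ T, c' - w / 2 < X i → X i ≤ c' + w / 2 → c' = c := by
    intro i
    by_cases h : ∃ c ∈ T, c - w / 2 < X i ∧ X i ≤ c + w / 2
    · obtain ⟨c, hc, h1, h2⟩ := h
      refine ⟨c, hc, ⟨h1, by linarith⟩, fun c' hc' h1' h2' => ?_⟩
      rcases lt_trichotomy c' c with h | h | h
      · linarith [hsep c' hc' c hc h]
      · exact h
      · linarith [hsep c hc c' hc' h]
    · push Not at h
      obtain ⟨c, hc, h1, h2⟩ := hcov _ (hXC i)
      exact ⟨c, hc, ⟨by linarith, h2⟩, fun c' hc' h1' h2' => absurd h2' (h c' hc' h1').not_ge⟩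
  choose g hgT hg huniq using hchoice
  refine ⟨fun i => g i + w / 4, ?_, fun i => ?_⟩
  · ext x
    constructor
    · rintro ⟨i, rfl⟩
      exact ⟨g i, hgT i, rfl⟩
    · rintro ⟨c, hc, rfl⟩
      obtain ⟨i, h1, h2⟩ := exists_mem_Ioc_of_limit hC (hlim c hc)
      exact ⟨i, by simp only [huniq i c hc h1 h2]⟩
  · rw [abs_lt]
    constructor <;> linarith [(hg i).1, (hg i).2]

end RobustRemainder

theorem theorem6 (L N : ℕ) (hN : 0 < N) (Γ : ℝ) (hΓ : 0 < Γ)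
    (M : Fin L → ℕ) (hMpos : ∀ l, 0 < M l) (hMmono : StrictMono M)
    (hMcop : Pairwise fun k l => Nat.Coprime (M k) (M l)) :
    ∃ decode : (Fin L → Set ℝ) → Set ℝ,
      ∀ (X : Fin N → ℝ) (Δpos Δneg : Fin L → Fin N → ℝ),
        (∀ i, X i ∈ Set.Ico 0 (RobustRemainder.dynamicRange Γ M N)) →
        (∀ l i, |Δpos l i| < Γ / 4 ∧ |Δneg l i| < Γ / 4) →
        ∃ Xhat : Fin N → ℝ,
          Set.range Xhat =
            decode (fun l => RobustRemainder.residueSet (Γ * (M l : ℝ)) X (Δpos l) (Δneg l)) ∧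
          ∀ i, |Xhat i - X i| < 3 * Γ / 4 := by
  obtain ⟨n, hn⟩ := exists_nat_ge (RobustRemainder.dynamicRange Γ M N / Γ)
  have hcut := fun R : Fin L → Set ℝ => RobustRemainder.exists_greedy_cut Γ n 0
    (RobustRemainder.candidates Γ M N R) fun y hy =>
      ⟨hy.1.1, by rw [zero_add]; exact hy.1.2.trans_le ((div_le_iff₀ hΓ).1 hn)⟩
  choose T hsep hcov hlim using hcut
  refine ⟨fun R => (fun c => c + Γ / 4) '' (T R : Set ℝ), fun X Δpos Δneg hX hΔ => ?_⟩
  exact RobustRemainder.exists_range_eq_image_of_cut (hsep _) (hcov _) (hlim _)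
    (RobustRemainder.mem_candidates hX hΔ)
    fun _ hy => RobustRemainder.exists_abs_sub_lt_of_mem_candidates hN hΓ hMpos hMmono hMcop hX hΔ hy
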